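/- Consider the budget-limited $K$-armed bandit. Pulling arm $i$ costs $c_i \ge 1$ and yields an independent reward drawn from a distribution with support in $[0,1]$ and mean $\mu_i$; the total cost of all pulls may not exceed a budget $B$. For an algorithm $A$ let $G(A)$ be its total reward. Its regret with budget $B$ is $$R(A) = \sup_{A'} \mathbf{E}[G(A')] - \mathbf{E}[G(A)],$$ where $A'$ ranges over all (possibly randomised) history-dependent pulling algorithms that almost surely respect the budget. Assume that the arm $I^* = \arg\max_i \mu_i/c_i$ is unique, and put $c_{\min} = \min_j c_j$, $d_{\min} = \min_{j \ne I^*}\left(\frac{\mu_{I^*}}{c_{I^*}} - \frac{\mu_j}{c_j}\right)$, $\Delta_j = \mu_{I^*} - \mu_j$ and $\delta_j = c_j - c_{I^*}$. Fractional KUBE is the following algorithm. Call an arm affordable if its cost does not exceed the residual budget. The algorithm stops as soon as no arm is affordable. It first pulls the arms once each, in order (passing over arms that are not affordable); after that, at each time step $t$ (the number of earlier pulls plus one), it pulls an affordable arm $i$ that maximises $$\frac{\hat\mu_{i}}{c_i} + \frac{1}{c_i}\sqrt{\frac{2\ln t}{n_{i}}}$$ (ties broken arbitrarily), where $n_{i}$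 is the number of earlier pulls of arm $i$ and $\hat\mu_{i}$ is the average of the rewards they gave. Then for every budget $B \ge c_{\min}$ the regret of fractional KUBE is at most $$\frac{8}{d_{\min}^2}\left(\sum_{\Delta_j>0}\Delta_j + \sum_{\delta_j>0}\frac{\delta_j}{c_{I^*}}\right)\ln\left(\frac{B}{c_{\min}}\right) + \left(\sum_{\Delta_j>0}\Delta_j + \sum_{\delta_j>0}\frac{\delta_j}{c_{I^*}}\right)\left(\frac{\pi^2}{3}+1\right) + 1.$$ (If $K=1$, then $d_{\min}$ is not defined, both sums are empty and the bound is $1$.) -/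

import Mathlib

open MeasureTheory

noncomputable section

/-- A budget-limited bandit machine with `K` arms: arm `i` has a reward distribution `law i`
supported in `[0, 1]` and a pulling cost `cost i ≥ 1`. -/
structure BudgetBandit (K : ℕ) where
  law : Fin K → Measure ℝ
  isProbabilityMeasure_law : ∀ i, IsProbabilityMeasure (law i)
  law_support : ∀ i, ∀ᵐ r ∂(law i), r ∈ Set.Icc (0 : ℝ) 1
  cost : Fin K → ℝ
  one_le_cost : ∀ i, 1 ≤ cost i

/-- A (possibly randomised, possibly stopping) arm-pulling algorithm. From its internal random
seed `u`, uniform on `[0, 1]`, and from the chronological list of the pulls made so far, each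
recorded with the reward it earned, it decides which arm to pull next, or to stop (`none`).
Decisions depend measurably on the seed and on the past. -/
structure PullingAlgorithm (K : ℕ) where
  next : unitInterval → List (Fin K × ℝ) → Option (Fin K)
  measurable_next : ∀ (n : ℕ) (a : Fin K),
    MeasurableSet {p : unitInterval × (Fin n → Fin K × ℝ) | next p.1 (List.ofFn p.2) = some a}

/-- The number of pulls of arm `i` recorded in a history. -/
def pullCount {K : ℕ} (h : List (Fin K × ℝ)) (i : Fin K) : ℕ :=
  (h.filter (fun p => p.1 = i)).length

/-- The average reward received from arm `i` in a history. -/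
def empiricalMean {K : ℕ} (h : List (Fin K × ℝ)) (i : Fin K) : ℝ :=
  ((h.filter (fun p => p.1 = i)).map Prod.snd).sum / (pullCount h i : ℝ)

namespace PullingAlgorithm

/-- The history after `t` time steps, when the seed is `u` and the `s`-th pull of arm `i`
(counted from `0`) yields the reward `x (i, s)`. Once the algorithm stops, the history no longer
changes. -/
def history {K : ℕ} (A : PullingAlgorithm K) (u : unitInterval) (x : Fin K × ℕ → ℝ) :
    ℕ → List (Fin K × ℝ)
  | 0 => []
  | t + 1 =>
    match A.next u (A.history u x t) with
    | none => A.history u x t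
    | some a => A.history u x t ++ [(a, x (a, pullCount (A.history u x t) a))]

/-- The reward earned in the time step that follows the first `t` ones (`0` after stopping). -/
def stepReward {K : ℕ} (A : PullingAlgorithm K) (u : unitInterval) (x : Fin K × ℕ → ℝ)
    (t : ℕ) : ℝ :=
  match A.next u (A.history u x t) with
  | none => 0
  | some a => x (a, pullCount (A.history u x t) a)

/-- The total reward. (An algorithm that respects a budget makes finitely many pulls, so for such
an algorithm this is a finite sum.) -/
def totalReward {K : ℕ} (A : PullingAlgorithm K) (u : unitInterval) (x : Fin K × ℕ → ℝ) : ℝ :=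
  ∑' t, A.stepReward u x t

end PullingAlgorithm

namespace BudgetBandit

instance {K : ℕ} (M : BudgetBandit K) (i : Fin K) : IsProbabilityMeasure (M.law i) :=
  M.isProbabilityMeasure_law i

/-- The mean reward `μ_i` of arm `i`. -/
def mean {K : ℕ} (M : BudgetBandit K) (i : Fin K) : ℝ :=
  ∫ r, r ∂(M.law i)

/-- The joint law of the seed and of all rewards: everything is independent, the seed is uniform
on `[0, 1]`, and every reward of arm `i` has the law of that arm. -/
def probability {K : ℕ} (M : BudgetBandit K) :
    Measure (unitInterval × (Fin K × ℕ → ℝ)) :=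
  (volume : Measure unitInterval).prod (Measure.infinitePi fun p : Fin K × ℕ => M.law p.1)

/-- The total cost of the pulls recorded in a history. -/
def totalCost {K : ℕ} (M : BudgetBandit K) (h : List (Fin K × ℝ)) : ℝ :=
  (h.map fun p => M.cost p.1).sum

/-- The algorithm `A` almost surely never spends more than the budget `B`. -/
def RespectsBudget {K : ℕ} (M : BudgetBandit K) (B : ℝ) (A : PullingAlgorithm K) : Prop :=
  ∀ᵐ ω ∂M.probability, ∀ t, M.totalCost (A.history ω.1 ω.2 t) ≤ B

/-- The expected total reward `E[G(A)]`. -/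
def expectedReward {K : ℕ} (M : BudgetBandit K) (A : PullingAlgorithm K) : ℝ :=
  ∫ ω, A.totalReward ω.1 ω.2 ∂M.probability

/-- The best expected total reward of an algorithm that respects the budget `B`. -/
def optimalReward {K : ℕ} (M : BudgetBandit K) (B : ℝ) : ℝ :=
  sSup {r : ℝ | ∃ A : PullingAlgorithm K, M.RespectsBudget B A ∧ r = M.expectedReward A}

/-- Sanity check for `optimalReward`: the expected total rewards of the algorithms that respect the
budget are bounded, so that the supremum is a genuine one. -/
theorem bddAbove_expectedReward {K : ℕ} (M : BudgetBandit K) (B : ℝ) :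
    BddAbove {r : ℝ | ∃ A : PullingAlgorithm K,
      M.RespectsBudget B A ∧ r = M.expectedReward A} := by
  refine ⟨B, ?_⟩
  rintro r ⟨A, hA, rfl⟩
  have : IsProbabilityMeasure M.probability := by unfold probability; infer_instance
  have hx : ∀ᵐ ω ∂M.probability, ∀ p : Fin K × ℕ, ω.2 p ∈ Set.Icc (0 : ℝ) 1 := by
    rw [ae_all_iff]
    intro p
    have h1 : ∀ᵐ x ∂(Measure.infinitePi fun p : Fin K × ℕ => M.law p.1),
        x p ∈ Set.Icc (0 : ℝ) 1 :=
      (measurePreserving_eval_infinitePi (fun p : Fin K × ℕ => M.law p.1)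
        p).quasiMeasurePreserving.ae (M.law_support p.1)
    exact Measure.quasiMeasurePreserving_snd.ae h1
  have hnn : ∀ ω : unitInterval × (Fin K × ℕ → ℝ), (∀ p, ω.2 p ∈ Set.Icc (0 : ℝ) 1) →
      ∀ t, 0 ≤ A.stepReward ω.1 ω.2 t := by
    intro ω h t
    unfold PullingAlgorithm.stepReward
    split
    · exact le_rfl
    · exact (h _).1
  have hle : ∀ ω : unitInterval × (Fin K × ℕ → ℝ), (∀ p, ω.2 p ∈ Set.Icc (0 : ℝ) 1) →
      ∀ t, ∑ k ∈ Finset.range t, A.stepReward ω.1 ω.2 k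
        ≤ M.totalCost (A.history ω.1 ω.2 t) := by
    intro ω h t
    induction t with
    | zero => simp [PullingAlgorithm.history, totalCost]
    | succ t ih =>
      rw [Finset.sum_range_succ]
      unfold PullingAlgorithm.stepReward at ih ⊢
      rw [PullingAlgorithm.history]
      cases hn : A.next ω.1 (A.history ω.1 ω.2 t) with
      | none => simpa using ih
      | some a =>
        have h1 := (h (a, pullCount (A.history ω.1 ω.2 t) a)).2
        have h2 := M.one_le_cost a
        simp only [totalCost, List.map_append, List.sum_append, List.map_cons, List.map_nil,
          List.sum_cons, List.sum_nil] at ih ⊢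
        linarith
  have hbound : ∫ ω, A.totalReward ω.1 ω.2 ∂M.probability ≤ ∫ _, B ∂M.probability := by
    refine integral_mono_of_nonneg ?_ (integrable_const B) ?_
    · filter_upwards [hx] with ω h
      exact tsum_nonneg (hnn ω h)
    · filter_upwards [hx, hA] with ω h hb
      exact Real.tsum_le_of_sum_range_le (hnn ω h) fun t => (hle ω h t).trans (hb t)
  simpa [expectedReward] using hbound

/-- The expected regret of `A` with budget `B`. -/
def regret {K : ℕ} (M : BudgetBandit K) (B : ℝ) (A : PullingAlgorithm K) : ℝ :=
  M.optimalReward B - M.expectedReward A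

/-- The upper confidence bound on the reward/cost ratio of arm `i` at the time step
`t = (number of earlier pulls) + 1`. -/
def ucbDensity {K : ℕ} (M : BudgetBandit K) (h : List (Fin K × ℝ)) (i : Fin K) : ℝ :=
  empiricalMean h i / M.cost i
    + Real.sqrt (2 * Real.log ((h.length : ℝ) + 1) / (pullCount h i : ℝ)) / M.cost i

/-- Arm `i` can still be paid with what is left of the budget `B` after the history `h`. -/
def Affordable {K : ℕ} (M : BudgetBandit K) (B : ℝ) (h : List (Fin K × ℝ)) (i : Fin K) : Prop :=
  M.cost i ≤ B - M.totalCost h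

/-- `A` is the fractional KUBE algorithm with budget `B` (ties are broken arbitrarily):
it stops when, and only when, no arm is affordable; it first pulls each affordable arm once, in
increasing order; afterwards it pulls an affordable arm with the largest upper confidence bound on
its reward/cost ratio. (An arm that is passed over in the initial phase stays unaffordable for
ever, so in the main phase every affordable arm has been pulled.) -/
structure IsFractionalKUBE {K : ℕ} (M : BudgetBandit K) (B : ℝ) (A : PullingAlgorithm K) :
    Prop where
  none_affordable : ∀ u h, (∀ i, ¬ M.Affordable B h i) → A.next u h = none
  initial_phase : ∀ u h i, M.Affordable B h i → pullCount h i = 0 →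
    (∀ j, j < i → M.Affordable B h j → pullCount h j ≠ 0) → A.next u h = some i
  main_phase : ∀ u h, (∃ i, M.Affordable B h i) → (∀ i, M.Affordable B h i → pullCount h i ≠ 0) →
    ∃ i, A.next u h = some i ∧ M.Affordable B h i ∧
      ∀ j, M.Affordable B h j → M.ucbDensity h j ≤ M.ucbDensity h i

/-- `I` is the unique arm with the highest true ratio of mean reward to cost. -/
def IsUniqueBestArm {K : ℕ} (M : BudgetBandit K) (I : Fin K) : Prop :=
  ∀ j, j ≠ I → M.mean j / M.cost j < M.mean I / M.cost I

/-- The smallest pulling cost. -/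
def cMin {K : ℕ} (M : BudgetBandit K) : ℝ :=
  ⨅ i, M.cost i

/-- The smallest gap between the ratio of mean reward to cost of `I` and that of another arm.
(With a single arm there is no gap, and the value is irrelevant.) -/
def dMin {K : ℕ} (M : BudgetBandit K) (I : Fin K) : ℝ :=
  ⨅ j : {j : Fin K // j ≠ I}, (M.mean I / M.cost I - M.mean j / M.cost j)

/-- The cost difference `δ_j = c_j - c_I`. -/
def costDiff {K : ℕ} (M : BudgetBandit K) (I j : Fin K) : ℝ :=
  M.cost j - M.cost I

/-- The mean reward difference `Δ_j = μ_I - μ_j`. -/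
def meanDiff {K : ℕ} (M : BudgetBandit K) (I j : Fin K) : ℝ :=
  M.mean I - M.mean j

end BudgetBandit

end

/-! Let ρ = μ_I / c_I. The decision to make a pull is taken before its reward is revealed, so
rewards may be replaced by the means of the pulled arms inside expectations (`integral_stepReward`).
Since every mean is at most ρ times the cost, no algorithm within budget earns more than ρB on
average (`optimalReward_le`).

For fractional KUBE, compare ρB with the means collected. While I is affordable, a pull of j loses
ρc_j - μ_j = Δ_j + ρδ_j, which is at most C_j = max(0, Δ_j) + max(0, δ_j / c_I) because ρ ≤ 1 / c_I.
Once I is unaffordable, the residual budget is below c_I, hence worth at most ρc_I = μ_I ≤ 1. So the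
loss is at most 1 + ∑ C_j N_j, where N_j counts the pulls of j made while I is affordable
(`mul_sub_sum_stepMean_le`).

The UCB argument bounds N_j: beyond about 8 ln(B / c_min) / d_min² pulls, j can beat an affordable I
only if a confidence bound fails (`mem_of_next_eq_some`). Hoeffding's inequality and a union bound
over times and sample sizes limit the expected number of failures to π²/3
(`integral_confidenceFailures_le`). -/

noncomputable section

/-! ### Pull counts and replayed histories -/

section PullCount

variable {K : ℕ}

theorem pullCount_nil (i : Fin K) : pullCount [] i = 0 := rfl

theorem pullCount_append_singleton (h : List (Fin K × ℝ)) (a : Fin K) (r : ℝ) (i : Fin K) :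
    pullCount (h ++ [(a, r)]) i = pullCount h i + if a = i then 1 else 0 := by
  unfold pullCount
  by_cases hi : a = i <;> simp [hi]

theorem pullCount_le_length (h : List (Fin K × ℝ)) (i : Fin K) : pullCount h i ≤ h.length :=
  List.length_filter_le _ _

theorem pullCount_eq_count (h : List (Fin K × ℝ)) (i : Fin K) :
    pullCount h i = (h.map Prod.fst).count i := by
  unfold pullCount
  induction h with
  | nil => rfl
  | cons p h ih => by_cases hp : p.1 = i <;> simp [hp, ih]

/-- The history in which the arms of `w` are pulled in order, with the rewards given by `x`. -/
def replay (x : Fin K × ℕ → ℝ) (w : List (Fin K)) : List (Fin K × ℝ) :=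
  List.ofFn fun k : Fin w.length => (w[k], x (w[k], (w.take k).count w[k]))

theorem length_replay (x : Fin K × ℕ → ℝ) (w : List (Fin K)) :
    (replay x w).length = w.length := by
  simp only [replay, List.length_ofFn]

theorem getElem_replay (x : Fin K × ℕ → ℝ) (w : List (Fin K)) {k : ℕ} (hk : k < w.length) :
    (replay x w)[k]'(by rwa [length_replay]) = (w[k], x (w[k], (w.take k).count w[k])) := by
  simp only [replay, List.getElem_ofFn, Fin.getElem_fin]

theorem replay_append_singleton (x : Fin K × ℕ → ℝ) (w : List (Fin K)) (a : Fin K) :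
    replay x (w ++ [a]) = replay x w ++ [(a, x (a, w.count a))] := by
  refine List.ext_getElem (by simp [length_replay]) fun k h1 h2 => ?_
  have hk : k < w.length + 1 := by simpa [length_replay] using h1
  rw [getElem_replay x (w ++ [a]) (by simpa using hk)]
  rcases Nat.lt_succ_iff_lt_or_eq.1 hk with hk | rfl
  · rw [List.getElem_append_left (as := replay x w) (h := by rwa [length_replay]), getElem_replay x w hk]
    simp [List.getElem_append_left hk, List.take_append_of_le_length hk.le]
  · rw [List.getElem_append_right (as := replay x w) (by simp [length_replay])]
    simp [length_replay]

end PullCount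

/-! ### Histories: non-anticipation and measurability -/

namespace PullingAlgorithm

variable {K : ℕ} (A : PullingAlgorithm K) (u : unitInterval) (x : Fin K × ℕ → ℝ)

theorem history_zero : A.history u x 0 = [] := rfl

theorem history_succ_of_none {t : ℕ} (h : A.next u (A.history u x t) = none) :
    A.history u x (t + 1) = A.history u x t := by
  rw [history, h]

theorem history_succ_of_some {t : ℕ} {a : Fin K} (h : A.next u (A.history u x t) = some a) :
    A.history u x (t + 1)
      = A.history u x t ++ [(a, x (a, pullCount (A.history u x t) a))] := by
  rw [history, h]

theorem stepReward_eq_elim (t : ℕ) :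
    A.stepReward u x t = (A.next u (A.history u x t)).elim 0
      fun a => x (a, pullCount (A.history u x t) a) := by
  unfold stepReward
  cases A.next u (A.history u x t) <;> rfl

theorem pullCount_history_succ (t : ℕ) (i : Fin K) :
    pullCount (A.history u x (t + 1)) i = pullCount (A.history u x t) i
      + if A.next u (A.history u x t) = some i then 1 else 0 := by
  cases h : A.next u (A.history u x t) with
  | none => simp [history_succ_of_none A u x h]
  | some a => simp [history_succ_of_some A u x h, pullCount_append_singleton]

theorem length_history_le (t : ℕ) : (A.history u x t).length ≤ t := by
  induction t with
  | zero => simp [history_zero]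
  | succ t ih =>
    cases h : A.next u (A.history u x t) with
    | none => rw [history_succ_of_none A u x h]; omega
    | some a => rw [history_succ_of_some A u x h]; simpa using ih

/-- Stopping is permanent: the seed is fixed and the history no longer changes, so the same decision
recurs. -/
theorem length_history_eq {t : ℕ} (ht : A.next u (A.history u x t) ≠ none) :
    (A.history u x t).length = t := by
  induction t with
  | zero => simp [history_zero]
  | succ t ih =>
    cases h : A.next u (A.history u x t) with
    | none => exact absurd h (by rwa [history_succ_of_none A u x h] at ht)
    | some a => rw [history_succ_of_some A u x h]; simpa using ih (by simp [h])

/-- This is the key to measurability: words of arms are countably many, and for a fixed word the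
history is an explicit measurable function of the rewards. -/
theorem history_eq_replay (t : ℕ) :
    A.history u x t = replay x ((A.history u x t).map Prod.fst) := by
  induction t with
  | zero => simp [history_zero, replay]
  | succ t ih =>
    cases h : A.next u (A.history u x t) with
    | none => rwa [history_succ_of_none A u x h]
    | some a =>
      rw [history_succ_of_some A u x h, List.map_append, List.map_cons, List.map_nil,
        replay_append_singleton, ← ih, ← pullCount_eq_count]

/-- The rewards of arm `i` in a history are the first ones of its reward sequence. -/
theorem sum_rewards_history (t : ℕ) (i : Fin K) :
    (((A.history u x t).filter (fun p => p.1 = i)).map Prod.snd).sum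
      = ∑ s ∈ Finset.range (pullCount (A.history u x t) i), x (i, s) := by
  induction t with
  | zero => simp [history_zero, pullCount_nil]
  | succ t ih =>
    cases h : A.next u (A.history u x t) with
    | none => rwa [history_succ_of_none A u x h]
    | some a =>
      rw [history_succ_of_some A u x h, pullCount_append_singleton]
      by_cases ha : a = i
      · subst ha
        simp [ih, Finset.sum_range_succ]
      · simp [ih, ha]

/-- The history only depends on the rewards that have been revealed. -/
theorem history_congr {x y : Fin K × ℕ → ℝ} {p : Fin K × ℕ} (hxy : ∀ q, q ≠ p → x q = y q)
    {t : ℕ} (ht : pullCount (A.history u x t) p.1 ≤ p.2) :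
    A.history u y t = A.history u x t := by
  induction t with
  | zero => rfl
  | succ t ih =>
    rw [pullCount_history_succ] at ht
    have ih := ih (by omega)
    cases h : A.next u (A.history u x t) with
    | none => rw [history_succ_of_none A u x h, history_succ_of_none A u y (by rwa [ih]), ih]
    | some a =>
      rw [history_succ_of_some A u x h, history_succ_of_some A u y (a := a) (by rwa [ih]), ih,
        hxy]
      -- Had this pull revealed the reward `p`, the count after it would exceed `p.2`, against `ht`.
      rintro rfl
      simp [h] at ht

/-- The event that the step after the first `t` ones is the `n`-th pull (counted from `0`) of
arm `a`. -/
def pullEvent (t : ℕ) (a : Fin K) (n : ℕ) : Set (unitInterval × (Fin K × ℕ → ℝ)) :=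
  {ω | A.next ω.1 (A.history ω.1 ω.2 t) = some a ∧ pullCount (A.history ω.1 ω.2 t) a = n}

/-- The reward of a pull is revealed only after the decision to make it, so altering that reward
cannot affect the event. -/
theorem mem_pullEvent_congr {x y : Fin K × ℕ → ℝ} {a : Fin K} {n : ℕ}
    (hxy : ∀ q, q ≠ (a, n) → x q = y q) {t : ℕ} :
    (u, x) ∈ A.pullEvent t a n ↔ (u, y) ∈ A.pullEvent t a n := by
  have key : ∀ {x y : Fin K × ℕ → ℝ}, (∀ q, q ≠ (a, n) → x q = y q) →
      (u, x) ∈ A.pullEvent t a n → (u, y) ∈ A.pullEvent t a n := by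
    intro x y hxy h
    have := A.history_congr u hxy (t := t) h.2.le
    simpa [pullEvent, this] using h
  exact ⟨key hxy, key fun q hq => (hxy q hq).symm⟩

/-- A quantity attached to the pull that follows the first `t` steps, as a sum over the arms and
the possible pull counts. -/
theorem sum_indicator_pullEvent (f : Fin K × ℕ → ℝ) (t : ℕ) :
    ∑ a, ∑ n ∈ Finset.range (t + 1), (A.pullEvent t a n).indicator (fun _ => f (a, n)) (u, x)
      = (A.next u (A.history u x t)).elim 0 fun a => f (a, pullCount (A.history u x t) a) := by
  classical
  cases h : A.next u (A.history u x t) with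
  | none =>
    refine Finset.sum_eq_zero fun a _ => Finset.sum_eq_zero fun n _ => ?_
    simp [pullEvent, h]
  | some b =>
    rw [Finset.sum_eq_single b, Finset.sum_eq_single (pullCount (A.history u x t) b)]
    · simp [pullEvent, h]
    · intro n _ hn
      simp [pullEvent, hn.symm]
    · intro hn
      have := (pullCount_le_length (A.history u x t) b).trans (A.length_history_le u x t)
      simp at hn
      omega
    · intro a _ ha
      refine Finset.sum_eq_zero fun n _ => ?_
      simp [pullEvent, h, ha.symm]
    · simp

theorem measurableSet_next_replay (w : List (Fin K)) (o : Option (Fin K)) :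
    MeasurableSet {ω : unitInterval × (Fin K × ℕ → ℝ) | A.next ω.1 (replay ω.2 w) = o} := by
  have hsome : ∀ a, MeasurableSet
      {ω : unitInterval × (Fin K × ℕ → ℝ) | A.next ω.1 (replay ω.2 w) = some a} := by
    intro a
    have hm : Measurable fun ω : unitInterval × (Fin K × ℕ → ℝ) =>
        (ω.1, fun k : Fin w.length => (w[k], ω.2 (w[k], (w.take k).count w[k]))) := by
      fun_prop
    exact hm (A.measurable_next w.length a)
  cases o with
  | some a => exact hsome a
  | none =>
    have : {ω : unitInterval × (Fin K × ℕ → ℝ) | A.next ω.1 (replay ω.2 w) = none}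
        = (⋃ a, {ω | A.next ω.1 (replay ω.2 w) = some a})ᶜ := by
      ext ω
      simp [Option.eq_none_iff_forall_ne_some]
    rw [this]
    exact (MeasurableSet.iUnion hsome).compl

theorem measurableSet_arms_history (t : ℕ) (w : List (Fin K)) :
    MeasurableSet {ω : unitInterval × (Fin K × ℕ → ℝ) |
      (A.history ω.1 ω.2 t).map Prod.fst = w} := by
  induction t generalizing w with
  | zero => simp [history_zero]
  | succ t ih =>
    have : {ω : unitInterval × (Fin K × ℕ → ℝ) | (A.history ω.1 ω.2 (t + 1)).map Prod.fst = w}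
        = ⋃ v : List (Fin K), {ω | (A.history ω.1 ω.2 t).map Prod.fst = v} ∩
          (({ω | A.next ω.1 (replay ω.2 v) = none} ∩ {_ω | v = w}) ∪
            ⋃ a, ({ω | A.next ω.1 (replay ω.2 v) = some a} ∩ {_ω | v ++ [a] = w})) := by
      ext ω
      simp only [Set.mem_iUnion, Set.mem_inter_iff, Set.mem_ofPred_eq, Set.mem_union,
        exists_eq_left']
      rw [← history_eq_replay]
      cases h : A.next ω.1 (A.history ω.1 ω.2 t) with
      | none => simp [history_succ_of_none A _ _ h]
      | some a => simp [history_succ_of_some A _ _ h]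
    rw [this]
    exact .iUnion fun v => (ih v).inter <| .union
      ((A.measurableSet_next_replay v none).inter (.const _)) <|
      .iUnion fun a => (A.measurableSet_next_replay v (some a)).inter (.const _)

theorem measurableSet_pullEvent (t : ℕ) (a : Fin K) (n : ℕ) :
    MeasurableSet (A.pullEvent t a n) := by
  have : A.pullEvent t a n = ⋃ v : List (Fin K), {ω | (A.history ω.1 ω.2 t).map Prod.fst = v} ∩
      ({ω | A.next ω.1 (replay ω.2 v) = some a} ∩ {_ω | v.count a = n}) := by
    ext ω
    simp only [Set.mem_iUnion, Set.mem_inter_iff, Set.mem_ofPred_eq, exists_eq_left']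
    rw [← history_eq_replay, ← pullCount_eq_count]
    rfl
  rw [this]
  exact .iUnion fun v => (A.measurableSet_arms_history t v).inter <|
    (A.measurableSet_next_replay v (some a)).inter (.const _)

end PullingAlgorithm

/-- Under a product measure, a coordinate is independent of all the others. -/
theorem indepFun_eval_update {ι : Type*} [DecidableEq ι] (P : ι → Measure ℝ)
    [∀ i, IsProbabilityMeasure (P i)] (p : ι) (c : ℝ) :
    ProbabilityTheory.IndepFun (fun x : ι → ℝ => x p) (fun x => Function.update x p c)
      (Measure.infinitePi P) := by
  have h := ProbabilityTheory.iIndepFun_infinitePi (P := P) (X := fun _ r => r)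
    fun _ => measurable_id
  have h2 := ProbabilityTheory.indep_iSup_of_disjoint
    (fun i => (measurable_pi_apply (X := fun _ : ι => ℝ) i).comap_le) h
    (S := {p}) (T := {p}ᶜ) disjoint_compl_right
  refine ProbabilityTheory.indep_of_indep_of_le_left
    (ProbabilityTheory.indep_of_indep_of_le_right h2 ?_) ?_
  -- Each coordinate of the updated family is either the constant `c` or a coordinate other than
  -- `p`, hence measurable for the σ-algebra of the complement of `{p}`.
  · rw [← measurable_iff_comap_le, @measurable_pi_iff]
    intro q
    by_cases hq : q = p
    · subst hq
      simp only [Function.update_self]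
      exact measurable_const
    · simp only [Function.update_of_ne hq]
      rw [measurable_iff_comap_le]
      exact le_iSup₂_of_le q hq le_rfl
  · exact le_iSup₂_of_le p rfl le_rfl

/-! ### Expected rewards, the benchmark ρB, and Hoeffding's inequality -/

namespace BudgetBandit

variable {K : ℕ} (M : BudgetBandit K)

instance : IsProbabilityMeasure M.probability := by
  unfold probability
  infer_instance

theorem measurePreserving_reward (p : Fin K × ℕ) :
    MeasurePreserving (fun ω : unitInterval × (Fin K × ℕ → ℝ) => ω.2 p) M.probability
      (M.law p.1) :=
  (measurePreserving_eval_infinitePi (fun p : Fin K × ℕ => M.law p.1) p).comp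
    measurePreserving_snd

theorem ae_reward_mem_Icc (p : Fin K × ℕ) :
    ∀ᵐ ω ∂M.probability, ω.2 p ∈ Set.Icc (0 : ℝ) 1 :=
  (M.measurePreserving_reward p).quasiMeasurePreserving.ae (M.law_support p.1)

theorem integrable_reward (p : Fin K × ℕ) :
    Integrable (fun ω : unitInterval × (Fin K × ℕ → ℝ) => ω.2 p) M.probability :=
  .of_mem_Icc 0 1 (by fun_prop) (M.ae_reward_mem_Icc p)

theorem integral_reward (p : Fin K × ℕ) :
    ∫ ω, ω.2 p ∂M.probability = M.mean p.1 :=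
  (M.measurePreserving_reward p).hasLaw.integral_eq

theorem mean_nonneg (i : Fin K) : 0 ≤ M.mean i :=
  integral_nonneg_of_ae <| (M.law_support i).mono fun _ hr => hr.1

theorem mean_le_one (i : Fin K) : M.mean i ≤ 1 := by
  have h : ∫ r, r ∂(M.law i) ≤ ∫ _, (1 : ℝ) ∂(M.law i) :=
    integral_mono_ae (.of_mem_Icc 0 1 (by fun_prop) (M.law_support i)) (integrable_const 1)
      ((M.law_support i).mono fun _ hr => hr.2)
  simpa [mean] using h

theorem cost_pos (i : Fin K) : 0 < M.cost i := one_pos.trans_le (M.one_le_cost i)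

/-- The reward of a pull is independent of the decision to make that pull. -/
theorem integral_indicator_pullEvent (A : PullingAlgorithm K) (t : ℕ) (a : Fin K) (n : ℕ) :
    ∫ ω, (A.pullEvent t a n).indicator (fun ω => ω.2 (a, n)) ω ∂M.probability
      = ∫ ω, (A.pullEvent t a n).indicator (fun _ => M.mean a) ω ∂M.probability := by
  classical
  have hE := A.measurableSet_pullEvent t a n
  have hint1 := (M.integrable_reward (a, n)).indicator hE
  have hint2 := (integrable_const (μ := M.probability) (M.mean a)).indicator hE
  unfold probability at hint1 hint2 ⊢
  -- Fubini freezes the seed, so independence is needed only among the rewards.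
  rw [integral_prod _ hint1, integral_prod _ hint2]
  congr 1 with u
  set ν := Measure.infinitePi fun p : Fin K × ℕ => M.law p.1
  set g : (Fin K × ℕ → ℝ) → ℝ := fun x => (A.pullEvent t a n).indicator (fun _ => 1) (u, x)
  have hg : Measurable g :=
    (measurable_const.indicator hE).comp measurable_prodMk_left
  have hind : ProbabilityTheory.IndepFun (fun x => x (a, n)) g ν := by
    have h := (indepFun_eval_update (fun p : Fin K × ℕ => M.law p.1) (a, n) 0).comp
      measurable_id hg
    -- Overwriting the reward `(a, n)` leaves `g` unchanged, so `g` inherits the independence of the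
    -- updated family.
    have hgu : g ∘ (fun x => Function.update x (a, n) 0) = g := by
      ext x
      have hx := A.mem_pullEvent_congr u (t := t) (y := x)
        fun q (hq : q ≠ (a, n)) => Function.update_of_ne hq 0 x
      by_cases hmem : (u, x) ∈ A.pullEvent t a n
      · simp [g, hmem, hx.2 hmem]
      · simp [g, hmem, mt hx.1 hmem]
    rwa [hgu] at h
  have hmean : ∫ x, x (a, n) ∂ν = M.mean a :=
    (measurePreserving_eval_infinitePi (fun p : Fin K × ℕ => M.law p.1) (a, n)).hasLaw.integral_eq
  have h1 : ∀ x, (A.pullEvent t a n).indicator (fun ω => ω.2 (a, n)) (u, x)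
      = x (a, n) * g x := fun x => by simp [g, Set.indicator_apply]
  have h2 : ∀ x, (A.pullEvent t a n).indicator (fun _ => M.mean a) (u, x)
      = M.mean a * g x := fun x => by simp [g, Set.indicator_apply]
  simp only [h1, h2]
  rw [hind.integral_fun_mul_eq_mul_integral
    (measurable_pi_apply _).aestronglyMeasurable hg.aestronglyMeasurable, hmean,
    integral_const_mul]

/-- The mean reward of the arm pulled in the time step that follows the first `t` ones. -/
def stepMean (A : PullingAlgorithm K) (u : unitInterval) (x : Fin K × ℕ → ℝ) (t : ℕ) : ℝ :=
  (A.next u (A.history u x t)).elim 0 M.mean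

theorem stepReward_eq_sum (A : PullingAlgorithm K) (t : ℕ)
    (ω : unitInterval × (Fin K × ℕ → ℝ)) :
    A.stepReward ω.1 ω.2 t = ∑ a, ∑ n ∈ Finset.range (t + 1),
      (A.pullEvent t a n).indicator (fun ω => ω.2 (a, n)) ω := by
  rw [A.stepReward_eq_elim, ← A.sum_indicator_pullEvent]
  refine Finset.sum_congr rfl fun a _ => Finset.sum_congr rfl fun n _ => ?_
  rfl

theorem stepMean_eq_sum (A : PullingAlgorithm K) (t : ℕ)
    (ω : unitInterval × (Fin K × ℕ → ℝ)) :
    M.stepMean A ω.1 ω.2 t = ∑ a, ∑ n ∈ Finset.range (t + 1),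
      (A.pullEvent t a n).indicator (fun _ => M.mean a) ω :=
  (A.sum_indicator_pullEvent ω.1 ω.2 (fun p => M.mean p.1) t).symm

theorem integrable_stepReward (A : PullingAlgorithm K) (t : ℕ) :
    Integrable (fun ω => A.stepReward ω.1 ω.2 t) M.probability := by
  simp only [stepReward_eq_sum]
  exact integrable_finsetSum _ fun a _ => integrable_finsetSum _ fun n _ =>
    (M.integrable_reward (a, n)).indicator (A.measurableSet_pullEvent t a n)

theorem integrable_stepMean (A : PullingAlgorithm K) (t : ℕ) :
    Integrable (fun ω => M.stepMean A ω.1 ω.2 t) M.probability := by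
  simp only [stepMean_eq_sum]
  exact integrable_finsetSum _ fun a _ => integrable_finsetSum _ fun n _ =>
    (integrable_const _).indicator (A.measurableSet_pullEvent t a n)

theorem integral_stepReward (A : PullingAlgorithm K) (t : ℕ) :
    ∫ ω, A.stepReward ω.1 ω.2 t ∂M.probability = ∫ ω, M.stepMean A ω.1 ω.2 t ∂M.probability := by
  simp only [stepReward_eq_sum, stepMean_eq_sum]
  have h1 := fun a n => (M.integrable_reward (a, n)).indicator (A.measurableSet_pullEvent t a n)
  have h2 := fun a n => (integrable_const (μ := M.probability) (M.mean a)).indicator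
    (A.measurableSet_pullEvent t a n)
  rw [integral_finsetSum _ fun a _ => integrable_finsetSum _ fun n _ => h1 a n,
    integral_finsetSum _ fun a _ => integrable_finsetSum _ fun n _ => h2 a n]
  refine Finset.sum_congr rfl fun a _ => ?_
  rw [integral_finsetSum _ fun n _ => h1 a n, integral_finsetSum _ fun n _ => h2 a n]
  exact Finset.sum_congr rfl fun n _ => M.integral_indicator_pullEvent A t a n

theorem totalCost_append_singleton (h : List (Fin K × ℝ)) (a : Fin K) (r : ℝ) :
    M.totalCost (h ++ [(a, r)]) = M.totalCost h + M.cost a := by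
  simp [totalCost]

theorem mul_length_le_totalCost {c : ℝ} (hc : ∀ i, c ≤ M.cost i) (h : List (Fin K × ℝ)) :
    c * h.length ≤ M.totalCost h := by
  induction h with
  | nil => simp [totalCost]
  | cons p h ih =>
    have := hc p.1
    simp only [totalCost, List.map_cons, List.sum_cons, List.length_cons] at ih ⊢
    push_cast
    linarith

theorem totalCost_history_succ (A : PullingAlgorithm K) (u : unitInterval)
    (x : Fin K × ℕ → ℝ) (t : ℕ) :
    M.totalCost (A.history u x (t + 1))
      = M.totalCost (A.history u x t) + (A.next u (A.history u x t)).elim 0 M.cost := by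
  cases h : A.next u (A.history u x t) with
  | none => simp [A.history_succ_of_none u x h]
  | some a => simp [A.history_succ_of_some u x h, totalCost_append_singleton]

/-- An algorithm that respects the budget makes at most `B / c` pulls when no arm is cheaper
than `c`. -/
theorem mul_le_of_next_ne_none {A : PullingAlgorithm K} {u : unitInterval}
    {x : Fin K × ℕ → ℝ} {B c : ℝ} (hB : ∀ t, M.totalCost (A.history u x t) ≤ B)
    (hc : ∀ i, c ≤ M.cost i) {t : ℕ} (ht : A.next u (A.history u x t) ≠ none) :
    c * (t + 1) ≤ B := by
  obtain ⟨a, ha⟩ := Option.ne_none_iff_exists'.1 ht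
  have h := (M.mul_length_le_totalCost hc _).trans (hB (t + 1))
  rw [A.history_succ_of_some u x ha, List.length_append, A.length_history_eq u x ht] at h
  simpa using h

theorem next_eq_none_of_floor_lt {A : PullingAlgorithm K} {u : unitInterval}
    {x : Fin K × ℕ → ℝ} {B : ℝ} (hB : ∀ t, M.totalCost (A.history u x t) ≤ B) {t : ℕ}
    (ht : ⌊B⌋₊ < t + 1) : A.next u (A.history u x t) = none := by
  by_contra h
  have h1 := M.mul_le_of_next_ne_none hB M.one_le_cost h
  have h2 := Nat.lt_of_floor_lt ht
  push_cast at h2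
  linarith

/-- Every pull costs at least 1, so almost surely all rewards come from the first `⌊B⌋₊` steps. The
series becomes a finite sum, which can be exchanged with the expectation. -/
theorem expectedReward_eq {A : PullingAlgorithm K} {B : ℝ} (hA : M.RespectsBudget B A) :
    M.expectedReward A
      = ∫ ω, ∑ t ∈ Finset.range ⌊B⌋₊, M.stepMean A ω.1 ω.2 t ∂M.probability := by
  rw [integral_finsetSum _ fun t _ => M.integrable_stepMean A t]
  simp only [← integral_stepReward]
  rw [← integral_finsetSum _ fun t _ => M.integrable_stepReward A t]
  refine integral_congr_ae (hA.mono fun ω hω => tsum_eq_sum fun t ht => ?_)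
  rw [A.stepReward_eq_elim, M.next_eq_none_of_floor_lt hω (by simp at ht; omega)]
  rfl

/-- No algorithm that respects the budget `B` earns more than `ρ B` on average, when `ρ` bounds
the ratios of mean reward to cost. -/
theorem optimalReward_le {B ρ : ℝ} (hB : 0 ≤ B) (hρ : 0 ≤ ρ) (h : ∀ i, M.mean i ≤ ρ * M.cost i) :
    M.optimalReward B ≤ ρ * B := by
  refine Real.sSup_le ?_ (by positivity)
  rintro r ⟨A, hA, rfl⟩
  rw [M.expectedReward_eq hA]
  have hsum : ∀ (ω : unitInterval × (Fin K × ℕ → ℝ)) (n : ℕ),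
      ∑ t ∈ Finset.range n, M.stepMean A ω.1 ω.2 t
        ≤ ρ * M.totalCost (A.history ω.1 ω.2 n) := by
    intro ω n
    induction n with
    | zero => simp [A.history_zero, totalCost]
    | succ n ih =>
      rw [Finset.sum_range_succ, totalCost_history_succ, mul_add]
      refine add_le_add ih ?_
      unfold stepMean
      cases A.next ω.1 (A.history ω.1 ω.2 n) with
      | none => simp
      | some a => exact h a
  have := integral_mono_ae (integrable_finsetSum (Finset.range ⌊B⌋₊)
    fun t _ => M.integrable_stepMean A t) (integrable_const (ρ * B))
    (hA.mono fun ω hω => (hsum ω _).trans (mul_le_mul_of_nonneg_left (hω _) hρ))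
  simpa using this

/-- Hoeffding's inequality for the first `s` rewards of arm `i`. -/
theorem measureReal_sum_reward_ge_le (i : Fin K) (s : ℕ) {ε : ℝ} (hε : 0 ≤ ε) :
    M.probability.real {ω | ε ≤ ∑ k ∈ Finset.range s, (ω.2 (i, k) - M.mean i)}
        ≤ Real.exp (-ε ^ 2 / (2 * s * (1 / 4)))
      ∧ M.probability.real {ω | ε ≤ ∑ k ∈ Finset.range s, -(ω.2 (i, k) - M.mean i)}
        ≤ Real.exp (-ε ^ 2 / (2 * s * (1 / 4))) := by
  have hindep : ProbabilityTheory.iIndepFun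
      (fun (k : ℕ) (ω : unitInterval × (Fin K × ℕ → ℝ)) => ω.2 (i, k)) M.probability := by
    have h := (ProbabilityTheory.iIndepFun_iff_hasLaw_Pi_infinitePi (P := M.probability)
      (X := fun p (ω : unitInterval × (Fin K × ℕ → ℝ)) => ω.2 p)
      (fun p => (M.measurePreserving_reward p).hasLaw) (by fun_prop)).2 measurePreserving_snd.hasLaw
    exact h.precomp (g := fun k : ℕ => (i, k)) (Prod.mk_right_injective i)
  -- Hoeffding's lemma: the variance proxy for an interval of length 1 is (1/2)² = 1/4.
  have hsub : ∀ k, ProbabilityTheory.HasSubgaussianMGF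
      (fun ω : unitInterval × (Fin K × ℕ → ℝ) => ω.2 (i, k) - M.mean i) (1 / 4)
      M.probability := by
    intro k
    have h := ProbabilityTheory.hasSubgaussianMGF_of_mem_Icc
      (M.integrable_reward (i, k)).aemeasurable (M.ae_reward_mem_Icc (i, k))
    rw [M.integral_reward (i, k)] at h
    convert h using 1
    norm_num
  have h1 := hindep.comp (fun _ r => r - M.mean i) fun _ => by fun_prop
  have h2 := hindep.comp (fun _ r => -(r - M.mean i)) fun _ => by fun_prop
  have h3 := ProbabilityTheory.HasSubgaussianMGF.measure_sum_range_ge_le_of_iIndepFun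
    h1 (n := s) (fun k _ => hsub k) hε
  have h4 := ProbabilityTheory.HasSubgaussianMGF.measure_sum_range_ge_le_of_iIndepFun
    h2 (n := s) (fun k _ => (hsub k).neg) hε
  exact ⟨h3, h4⟩

end BudgetBandit

/-! ### The loss of fractional KUBE against ρB -/

namespace BudgetBandit

variable {K : ℕ} {M : BudgetBandit K} {B : ℝ} {A : PullingAlgorithm K}

/-- If an affordable arm is still unpulled, the least such arm is chosen. Choosing an arm pulled
before thus certifies the main phase, where no affordable arm has the division-by-zero value of
`ucbDensity`. -/
theorem IsFractionalKUBE.of_next_eq_some (hA : M.IsFractionalKUBE B A) {u : unitInterval}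
    {h : List (Fin K × ℝ)} {a : Fin K} (ha : A.next u h = some a) :
    M.Affordable B h a ∧ (pullCount h a ≠ 0 → ∀ j, M.Affordable B h j →
      pullCount h j ≠ 0 ∧ M.ucbDensity h j ≤ M.ucbDensity h a) := by
  by_cases hex : ∃ i, M.Affordable B h i
  · by_cases hnew : ∃ i, M.Affordable B h i ∧ pullCount h i = 0
    · obtain ⟨i, ⟨hi1, hi2⟩, hmin⟩ := WellFounded.has_min (wellFounded_lt (α := Fin K))
        {i | M.Affordable B h i ∧ pullCount h i = 0} hnew
      have hi := hA.initial_phase u h i hi1 hi2 fun j hj hj1 hj2 => hmin j ⟨hj1, hj2⟩ hj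
      obtain rfl : i = a := by simpa [hi] using ha
      exact ⟨hi1, fun hne => absurd hi2 hne⟩
    · push Not at hnew
      obtain ⟨i, hi, hi1, hi2⟩ := hA.main_phase u h hex hnew
      obtain rfl : i = a := by simpa [hi] using ha
      exact ⟨hi1, fun _ j hj => ⟨hnew j hj, hi2 j hj⟩⟩
  · push Not at hex
    simp [hA.none_affordable u h hex] at ha

theorem IsFractionalKUBE.next_ne_none (hA : M.IsFractionalKUBE B A) (u : unitInterval)
    {h : List (Fin K × ℝ)} {i : Fin K} (hi : M.Affordable B h i) : A.next u h ≠ none := by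
  by_cases hnew : ∃ i, M.Affordable B h i ∧ pullCount h i = 0
  · obtain ⟨i, ⟨hi1, hi2⟩, hmin⟩ := WellFounded.has_min (wellFounded_lt (α := Fin K))
      {i | M.Affordable B h i ∧ pullCount h i = 0} hnew
    simp [hA.initial_phase u h i hi1 hi2 fun j hj hj1 hj2 => hmin j ⟨hj1, hj2⟩ hj]
  · push Not at hnew
    obtain ⟨i, hi, -⟩ := hA.main_phase u h ⟨i, hi⟩ hnew
    simp [hi]

theorem IsFractionalKUBE.totalCost_history_le (hA : M.IsFractionalKUBE B A) (hB : 0 ≤ B)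
    (u : unitInterval) (x : Fin K × ℕ → ℝ) (t : ℕ) :
    M.totalCost (A.history u x t) ≤ B := by
  induction t with
  | zero => simpa [A.history_zero, totalCost] using hB
  | succ t ih =>
    rw [totalCost_history_succ]
    cases h : A.next u (A.history u x t) with
    | none => simpa using ih
    | some a =>
      have := (hA.of_next_eq_some h).1
      simp only [Affordable, Option.elim_some] at this ⊢
      linarith

open Classical in
/-- Whether, in the time step that follows the first `t` ones, arm `j` is pulled while arm `I` is
affordable (`1` if so, `0` otherwise). -/
def pullWhile (M : BudgetBandit K) (B : ℝ) (A : PullingAlgorithm K) (I j : Fin K)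
    (u : unitInterval) (x : Fin K × ℕ → ℝ) (t : ℕ) : ℝ :=
  if A.next u (A.history u x t) = some j ∧ M.Affordable B (A.history u x t) I then 1 else 0

theorem pullWhile_nonneg (I j : Fin K) (u : unitInterval) (x : Fin K × ℕ → ℝ) (t : ℕ) :
    0 ≤ M.pullWhile B A I j u x t := by
  unfold pullWhile
  split <;> norm_num

theorem stepMean_nonneg (u : unitInterval) (x : Fin K × ℕ → ℝ) (t : ℕ) :
    0 ≤ M.stepMean A u x t := by
  unfold stepMean
  cases A.next u (A.history u x t) with
  | none => simp
  | some a => exact M.mean_nonneg a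

/-- The loss against `ρ B`, where `ρ` is the best ratio, is caused by the pulls made while the best
arm `I` is affordable, up to the value of what is left afterwards, which is at most `1`. -/
theorem IsFractionalKUBE.mul_sub_sum_stepMean_le (hA : M.IsFractionalKUBE B A) (hB : 0 ≤ B)
    {I : Fin K} {ρ : ℝ} (hρ : 0 ≤ ρ) (hI : ρ * M.cost I ≤ 1) {C : Fin K → ℝ}
    (hC0 : ∀ j, 0 ≤ C j) (hC : ∀ j, ρ * M.cost j - M.mean j ≤ C j)
    (u : unitInterval) (x : Fin K × ℕ → ℝ) :
    ρ * B - ∑ t ∈ Finset.range ⌊B⌋₊, M.stepMean A u x t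
      ≤ 1 + ∑ j, C j * ∑ t ∈ Finset.range ⌊B⌋₊, M.pullWhile B A I j u x t := by
  classical
  -- While I is affordable, the value of the residual budget serves as a potential, and each pull of
  -- `a` is charged `C a`. At the crossing this value is at most 1; afterwards I stays unaffordable
  -- and the left side can only decrease.
  have key : ∀ n, ρ * B - ∑ t ∈ Finset.range n, M.stepMean A u x t
      - ∑ t ∈ Finset.range n, ∑ j, C j * M.pullWhile B A I j u x t
      ≤ if M.Affordable B (A.history u x n) I then ρ * (B - M.totalCost (A.history u x n))
        else 1 := by
    have hdone : ∀ n, ¬ M.Affordable B (A.history u x n) I →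
        ρ * (B - M.totalCost (A.history u x n)) ≤ 1 := by
      intro n hn
      refine (mul_le_mul_of_nonneg_left ?_ hρ).trans hI
      exact (not_le.1 hn).le
    intro n
    induction n with
    | zero =>
      split_ifs with h
      · simp [A.history_zero, totalCost]
      · simpa [A.history_zero, totalCost] using hdone 0 h
    | succ n ih =>
      rw [Finset.sum_range_succ, Finset.sum_range_succ]
      by_cases haff : M.Affordable B (A.history u x n) I
      · rw [if_pos haff] at ih
        obtain ⟨a, ha⟩ := Option.ne_none_iff_exists'.1 (hA.next_ne_none u haff)
        have h1 : ∑ j, C j * M.pullWhile B A I j u x n = C a := by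
          simp [pullWhile, ha, haff]
        have h2 : M.stepMean A u x n = M.mean a := by simp [stepMean, ha]
        have h3 := M.totalCost_history_succ A u x n
        rw [ha, Option.elim_some] at h3
        have h4 := hC a
        have h5 : ρ * (B - M.totalCost (A.history u x (n + 1)))
            = ρ * (B - M.totalCost (A.history u x n)) - ρ * M.cost a := by rw [h3]; ring
        rw [h1, h2]
        split_ifs with h
        · linarith
        · have := hdone _ h
          linarith
      · rw [if_neg haff] at ih
        have h1 : 0 ≤ ∑ j, C j * M.pullWhile B A I j u x n :=
          Finset.sum_nonneg fun j _ => mul_nonneg (hC0 j) (pullWhile_nonneg I j u x n)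
        have h2 := stepMean_nonneg (M := M) (A := A) u x n
        have h3 : ¬ M.Affordable B (A.history u x (n + 1)) I := by
          unfold Affordable at haff ⊢
          rw [totalCost_history_succ]
          have : 0 ≤ (A.next u (A.history u x n)).elim 0 M.cost := by
            cases A.next u (A.history u x n) with
            | none => simp
            | some a => exact (M.cost_pos a).le
          linarith
        rw [if_neg h3]
        linarith
  have hfin : ¬ M.Affordable B (A.history u x ⌊B⌋₊) I := fun h =>
    hA.next_ne_none u h <|
      M.next_eq_none_of_floor_lt (hA.totalCost_history_le hB u x) (Nat.lt_succ_self _)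
  have := key ⌊B⌋₊
  rw [if_neg hfin, Finset.sum_comm] at this
  simp only [← Finset.mul_sum] at this
  linarith

/-! ### Confidence bounds and the pulls of suboptimal arms -/

/-- The event that the first `s` rewards of arm `i` exceed their mean by `ε` in total. -/
def overestimate (M : BudgetBandit K) (i : Fin K) (s : ℕ) (ε : ℝ) :
    Set (unitInterval × (Fin K × ℕ → ℝ)) :=
  {ω | ε ≤ ∑ k ∈ Finset.range s, (ω.2 (i, k) - M.mean i)}

/-- The event that the first `s` rewards of arm `i` fall short of their mean by `ε` in total. -/
def underestimate (M : BudgetBandit K) (i : Fin K) (s : ℕ) (ε : ℝ) :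
    Set (unitInterval × (Fin K × ℕ → ℝ)) :=
  {ω | ε ≤ ∑ k ∈ Finset.range s, -(ω.2 (i, k) - M.mean i)}

theorem measurableSet_overestimate (i : Fin K) (s : ℕ) (ε : ℝ) :
    MeasurableSet (M.overestimate i s ε) :=
  measurableSet_le measurable_const (by fun_prop)

theorem measurableSet_underestimate (i : Fin K) (s : ℕ) (ε : ℝ) :
    MeasurableSet (M.underestimate i s ε) :=
  measurableSet_le measurable_const (by fun_prop)

/-- The radius is chosen so that Hoeffding's exponent is -4 ln(t + 1). -/
theorem exp_confidence (t : ℕ) {s : ℕ} (hs : s ≠ 0) :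
    Real.exp (-√(2 * s * Real.log (t + 1)) ^ 2 / (2 * s * (1 / 4))) = 1 / ((t : ℝ) + 1) ^ 4 := by
  have hs' : (s : ℝ) ≠ 0 := by exact_mod_cast hs
  have hlog : 0 ≤ Real.log ((t : ℝ) + 1) := Real.log_nonneg (by simp)
  have : -√(2 * s * Real.log (t + 1)) ^ 2 / (2 * s * (1 / 4))
      = -Real.log (((t : ℝ) + 1) ^ 4) := by
    rw [Real.sq_sqrt (by positivity), Real.log_pow]
    field_simp
    norm_num
  rw [this, Real.exp_neg, Real.exp_log (by positivity), one_div]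

theorem sum_range_inv_sq_le (n : ℕ) :
    ∑ t ∈ Finset.range n, 1 / ((t : ℝ) + 1) ^ 2 ≤ Real.pi ^ 2 / 6 := by
  -- The dropped term at index 0 is `1 / 0 = 0`, so the shifted series keeps the sum π²/6.
  have h := (hasSum_nat_add_iff' 1).2 hasSum_zeta_two
  simp only [Finset.range_one, Finset.sum_singleton, Nat.cast_zero, ne_eq, OfNat.ofNat_ne_zero,
    not_false_eq_true, zero_pow, div_zero, sub_zero, Nat.cast_add, Nat.cast_one] at h
  exact sum_le_hasSum _ (fun t _ => by positivity) h

/-- The number of pairs of a time step `t < n` and a positive number of pulls at most `t` at which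
the confidence bound of `I` is too low or the one of `j` is too high. -/
def confidenceFailures (M : BudgetBandit K) (I j : Fin K) (n : ℕ)
    (ω : unitInterval × (Fin K × ℕ → ℝ)) : ℝ :=
  ∑ t ∈ Finset.range n, ∑ s ∈ Finset.Icc 1 t,
    ((M.underestimate I s √(2 * s * Real.log (t + 1))).indicator (fun _ => 1) ω
      + (M.overestimate j s √(2 * s * Real.log (t + 1))).indicator (fun _ => 1) ω)

theorem integrable_confidenceFailures (I j : Fin K) (n : ℕ) :
    Integrable (M.confidenceFailures I j n) M.probability := by
  unfold confidenceFailures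
  exact integrable_finsetSum _ fun t _ => integrable_finsetSum _ fun s _ =>
    ((integrable_const _).indicator (measurableSet_underestimate ..)).add
      ((integrable_const _).indicator (measurableSet_overestimate ..))

/-- Fixed sample sizes `s` make Hoeffding's inequality applicable despite the random pull counts.
Step `t` contributes at most 2t / (t + 1)⁴ ≤ 2 / (t + 1)², and these sum to at most 2 · π²/6. -/
theorem integral_confidenceFailures_le (I j : Fin K) (n : ℕ) :
    ∫ ω, M.confidenceFailures I j n ω ∂M.probability ≤ Real.pi ^ 2 / 3 := by
  have hI := fun s (ε : ℝ) => (integrable_const (μ := M.probability) (1 : ℝ)).indicator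
    (M.measurableSet_underestimate I s ε)
  have hj := fun s (ε : ℝ) => (integrable_const (μ := M.probability) (1 : ℝ)).indicator
    (M.measurableSet_overestimate j s ε)
  have hIj := fun s (ε : ℝ) => (hI s ε).add (hj s ε)
  simp only [Pi.add_def] at hIj
  unfold confidenceFailures
  rw [integral_finsetSum _ fun t _ => integrable_finsetSum _ fun s _ => hIj s _]
  have hstep : ∀ t : ℕ, ∫ ω, ∑ s ∈ Finset.Icc 1 t,
      ((M.underestimate I s √(2 * s * Real.log (t + 1))).indicator (fun _ => 1) ω
        + (M.overestimate j s √(2 * s * Real.log (t + 1))).indicator (fun _ => 1) ω)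
        ∂M.probability ≤ 2 * (1 / ((t : ℝ) + 1) ^ 2) := by
    intro t
    rw [integral_finsetSum _ fun s _ => hIj s _]
    have hterm : ∀ s ∈ Finset.Icc 1 t, ∫ ω,
        ((M.underestimate I s √(2 * s * Real.log (t + 1))).indicator (fun _ => (1 : ℝ)) ω
          + (M.overestimate j s √(2 * s * Real.log (t + 1))).indicator (fun _ => 1) ω)
          ∂M.probability ≤ 2 * (1 / ((t : ℝ) + 1) ^ 4) := by
      intro s hs
      have hs0 : s ≠ 0 := by
        have := (Finset.mem_Icc.1 hs).1
        omega
      rw [integral_add (hI s _) (hj s _), integral_indicator_const _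
        (measurableSet_underestimate ..), integral_indicator_const _
        (measurableSet_overestimate ..), smul_eq_mul, smul_eq_mul, mul_one, mul_one,
        ← exp_confidence t hs0, two_mul (Real.exp _)]
      exact add_le_add (M.measureReal_sum_reward_ge_le I s (Real.sqrt_nonneg _)).2
        (M.measureReal_sum_reward_ge_le j s (Real.sqrt_nonneg _)).1
    refine (Finset.sum_le_sum hterm).trans ?_
    rw [Finset.sum_const, Nat.card_Icc, nsmul_eq_mul, Nat.add_sub_cancel]
    have ht : (0 : ℝ) ≤ t := t.cast_nonneg
    rw [mul_left_comm]
    refine mul_le_mul_of_nonneg_left ?_ zero_le_two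
    rw [mul_one_div, div_le_div_iff₀ (by positivity) (by positivity)]
    nlinarith [pow_nonneg ht 2, pow_nonneg ht 3, pow_nonneg ht 4]
  refine (Finset.sum_le_sum fun t _ => hstep t).trans ?_
  rw [← Finset.mul_sum]
  linarith [sum_range_inv_sq_le n]

theorem le_indicator_sum_of_mem {α : Type*} {n : ℕ} (E : ℕ → Set α) {s : ℕ}
    (hs : s ∈ Finset.Icc 1 n) {ω : α} (hω : ω ∈ E s) :
    1 ≤ ∑ s ∈ Finset.Icc 1 n, (E s).indicator (fun _ => (1 : ℝ)) ω := by
  have h := Finset.single_le_sum (f := fun s => (E s).indicator (fun _ => (1 : ℝ)) ω)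
    (fun s _ => Set.indicator_nonneg (fun _ _ => zero_le_one) ω) hs
  simpa [hω] using h

theorem empiricalMean_history (A : PullingAlgorithm K) (u : unitInterval) (x : Fin K × ℕ → ℝ)
    (t : ℕ) (i : Fin K) :
    empiricalMean (A.history u x t) i
      = (∑ s ∈ Finset.range (pullCount (A.history u x t) i), x (i, s))
        / pullCount (A.history u x t) i := by
  rw [empiricalMean, A.sum_rewards_history]

theorem confidence_div {s : ℕ} (hs : s ≠ 0) (L : ℝ) : √(2 * s * L) / s = √(2 * L / s) := by
  have hs' : (0 : ℝ) < s := by exact_mod_cast Nat.pos_of_ne_zero hs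
  rw [show 2 * L / (s : ℝ) = 2 * s * L / s ^ 2 by field_simp, Real.sqrt_div' _ (by positivity),
    Real.sqrt_sq hs'.le]

/-- A suboptimal arm that has been pulled often enough is only pulled, while the best arm is
affordable, when a confidence bound fails. -/
theorem IsFractionalKUBE.mem_of_next_eq_some (hA : M.IsFractionalKUBE B A) {I j : Fin K}
    {d T : ℝ} (hd : 0 < d) (hgap : d ≤ M.mean I / M.cost I - M.mean j / M.cost j)
    {ω : unitInterval × (Fin K × ℕ → ℝ)} {t : ℕ} (hT : (t : ℝ) + 1 ≤ T)
    (hj : A.next ω.1 (A.history ω.1 ω.2 t) = some j)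
    (hI : M.Affordable B (A.history ω.1 ω.2 t) I)
    (hn : 8 / d ^ 2 * Real.log T < pullCount (A.history ω.1 ω.2 t) j) :
    (∃ s ∈ Finset.Icc 1 t, ω ∈ M.underestimate I s √(2 * s * Real.log (t + 1))) ∨
      ∃ s ∈ Finset.Icc 1 t, ω ∈ M.overestimate j s √(2 * s * Real.log (t + 1)) := by
  have ht0 : (0 : ℝ) ≤ t := t.cast_nonneg
  have hlog0 : 0 ≤ Real.log ((t : ℝ) + 1) := Real.log_nonneg (by linarith)
  have hlog : Real.log ((t : ℝ) + 1) ≤ Real.log T := Real.log_le_log (by linarith) hT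
  have hlen := A.length_history_eq ω.1 ω.2 (t := t) (by simp [hj])
  set h := A.history ω.1 ω.2 t with hh
  have hn0 : pullCount h j ≠ 0 := by
    rintro h0
    rw [h0, Nat.cast_zero] at hn
    have : 0 ≤ 8 / d ^ 2 * Real.log T := mul_nonneg (by positivity) (hlog0.trans hlog)
    linarith
  obtain ⟨hm0, hucb⟩ := (hA.of_next_eq_some hj).2 hn0 I hI
  by_contra hcon
  push Not at hcon
  have hmem : ∀ i, pullCount h i ≠ 0 → pullCount h i ∈ Finset.Icc 1 t := fun i hi =>
    Finset.mem_Icc.2 ⟨Nat.pos_of_ne_zero hi, hlen ▸ pullCount_le_length h i⟩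
  have h1 := hcon.1 _ (hmem I hm0)
  have h2 := hcon.2 _ (hmem j hn0)
  rw [underestimate, Set.mem_ofPred_eq, not_le, Finset.sum_neg_distrib, Finset.sum_sub_distrib,
    Finset.sum_const, Finset.card_range,
    nsmul_eq_mul] at h1
  rw [overestimate, Set.mem_ofPred_eq, not_le, Finset.sum_sub_distrib, Finset.sum_const,
    Finset.card_range, nsmul_eq_mul] at h2
  have hm' : (0 : ℝ) < pullCount h I := by exact_mod_cast Nat.pos_of_ne_zero hm0
  have hn' : (0 : ℝ) < pullCount h j := by exact_mod_cast Nat.pos_of_ne_zero hn0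
  have hcI := M.cost_pos I
  have hcj := M.cost_pos j
  have hmeanI : M.mean I < empiricalMean h I + √(2 * Real.log (t + 1) / pullCount h I) := by
    rw [hh, empiricalMean_history, ← hh, ← confidence_div hm0, ← add_div, lt_div_iff₀ hm']
    linarith
  have hmeanj : empiricalMean h j < M.mean j + √(2 * Real.log (t + 1) / pullCount h j) := by
    rw [hh, empiricalMean_history, ← hh, ← confidence_div hn0, ← sub_lt_iff_lt_add',
      lt_div_iff₀ hn', sub_mul, div_mul_cancel₀ _ hn'.ne']
    linarith
  simp only [ucbDensity, hlen, ← add_div] at hucb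
  set r := √(2 * Real.log (t + 1) / pullCount h j) with hr
  have hr0 : 0 ≤ r := Real.sqrt_nonneg _
  have h3 := div_lt_div_of_pos_right hmeanI hcI
  have h4 : (empiricalMean h j + r) / M.cost j < (M.mean j + 2 * r) / M.cost j :=
    div_lt_div_of_pos_right (by linarith) hcj
  -- Costs at least 1 only shrink the radius, which keeps the factor 8 / d² free of costs.
  have h5 : 2 * r / M.cost j ≤ 2 * r := div_le_self (by linarith) (M.one_le_cost j)
  rw [add_div (M.mean j)] at h4
  -- The chain is μ_I / c_I < UCB of I ≤ UCB of j < μ_j / c_j + 2r / c_j. Squaring then bounds the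
  -- pull count of j by 8 ln T / d², against `hn`.
  have h6 : d < 2 * r := by linarith
  have h7 : d ^ 2 < 8 * Real.log T / pullCount h j := by
    calc d ^ 2 < (2 * r) ^ 2 := by gcongr
      _ = 8 * Real.log (t + 1) / pullCount h j := by
        rw [mul_pow, hr, Real.sq_sqrt (by positivity)]
        ring
      _ ≤ _ := by gcongr
  rw [lt_div_iff₀ hn'] at h7
  rw [div_mul_eq_mul_div, div_lt_iff₀ (by positivity)] at hn
  linarith

-- Each pull of `j` raises its count, so the counts just before these pulls are distinct naturals in
-- `0, …, ⌊l⌋₊`; counting from 0 gives the `+ 1`.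
open Classical in
theorem sum_pullWhile_le_of_pullCount (I j : Fin K) (u : unitInterval) (x : Fin K × ℕ → ℝ)
    (n : ℕ) {l : ℝ} (hl : 0 ≤ l) :
    ∑ t ∈ Finset.range n, (if (pullCount (A.history u x t) j : ℝ) ≤ l
      then M.pullWhile B A I j u x t else 0) ≤ l + 1 := by
  have hcount : ∀ n, ∀ t < n, A.next u (A.history u x t) = some j →
      pullCount (A.history u x t) j < pullCount (A.history u x n) j := by
    intro n
    induction n with
    | zero => simp
    | succ n ih =>
      intro t ht hnext
      rw [A.pullCount_history_succ u x n]
      rcases Nat.lt_succ_iff_lt_or_eq.1 ht with ht | rfl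
      · exact (ih t ht hnext).trans_le (Nat.le_add_right _ _)
      · simp [hnext]
  simp only [pullWhile, ← ite_and]
  rw [Finset.sum_boole]
  have hcard := Finset.card_le_card_of_injOn (s := (Finset.range n).filter fun t =>
      (pullCount (A.history u x t) j : ℝ) ≤ l ∧ A.next u (A.history u x t) = some j ∧
        M.Affordable B (A.history u x t) I)
    (t := Finset.range (⌊l⌋₊ + 1)) (fun t => pullCount (A.history u x t) j)
    (fun t ht => by
      simp only [Finset.coe_filter, Set.mem_ofPred_eq] at ht
      simpa [Nat.lt_succ_iff] using Nat.le_floor ht.2.1)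
    (fun t ht s hs hts => by
      simp only [Finset.coe_filter, Set.mem_ofPred_eq] at ht hs hts
      rcases lt_trichotomy t s with h | h | h
      · exact absurd hts (hcount s t h ht.2.2.1).ne
      · exact h
      · exact absurd hts (hcount t s h hs.2.2.1).ne')
  rw [Finset.card_range] at hcard
  calc _ ≤ ((⌊l⌋₊ + 1 : ℕ) : ℝ) := by exact_mod_cast hcard
    _ ≤ l + 1 := by
      push_cast
      linarith [Nat.floor_le hl]

/-- Pulls made when the count of `j` is at most `l` number at most `l + 1`; each later one is
charged to a confidence failure at the same time step. -/
theorem IsFractionalKUBE.sum_pullWhile_le (hA : M.IsFractionalKUBE B A) (hB : 0 ≤ B)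
    {I j : Fin K} {c d : ℝ} (hc : 0 < c) (hcost : ∀ i, c ≤ M.cost i) (hcB : c ≤ B) (hd : 0 < d)
    (hgap : d ≤ M.mean I / M.cost I - M.mean j / M.cost j) (n : ℕ)
    (ω : unitInterval × (Fin K × ℕ → ℝ)) :
    ∑ t ∈ Finset.range n, M.pullWhile B A I j ω.1 ω.2 t
      ≤ 8 / d ^ 2 * Real.log (B / c) + 1 + M.confidenceFailures I j n ω := by
  classical
  set l := 8 / d ^ 2 * Real.log (B / c) with hl
  have hl0 : 0 ≤ l := by
    have : 0 ≤ Real.log (B / c) := Real.log_nonneg ((one_le_div hc).2 hcB)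
    positivity
  refine le_trans ?_ (add_le_add_left
    (sum_pullWhile_le_of_pullCount (M := M) (B := B) (A := A) I j ω.1 ω.2 n hl0) _)
  unfold confidenceFailures
  rw [← Finset.sum_add_distrib]
  refine Finset.sum_le_sum fun t _ => ?_
  rw [Finset.sum_add_distrib]
  have hu : 0 ≤ ∑ s ∈ Finset.Icc 1 t,
      (M.underestimate I s √(2 * s * Real.log (t + 1))).indicator (fun _ => (1 : ℝ)) ω :=
    Finset.sum_nonneg fun s _ => Set.indicator_nonneg (fun _ _ => zero_le_one) ω
  have ho : 0 ≤ ∑ s ∈ Finset.Icc 1 t,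
      (M.overestimate j s √(2 * s * Real.log (t + 1))).indicator (fun _ => (1 : ℝ)) ω :=
    Finset.sum_nonneg fun s _ => Set.indicator_nonneg (fun _ _ => zero_le_one) ω
  split_ifs with hcount
  · linarith
  rw [zero_add]
  unfold pullWhile
  split_ifs with hpull
  · have hT : (t : ℝ) + 1 ≤ B / c := by
      rw [le_div_iff₀ hc, mul_comm]
      exact M.mul_le_of_next_ne_none (hA.totalCost_history_le hB ω.1 ω.2) hcost
        (by simp [hpull.1])
    rcases hA.mem_of_next_eq_some hd hgap hT hpull.1 hpull.2 (not_le.1 hcount) with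
      ⟨s, hs, hω⟩ | ⟨s, hs, hω⟩
    · have := le_indicator_sum_of_mem
        (fun s : ℕ => M.underestimate I s √(2 * s * Real.log (t + 1))) hs hω
      linarith
    · have := le_indicator_sum_of_mem
        (fun s : ℕ => M.overestimate j s √(2 * s * Real.log (t + 1))) hs hω
      linarith
  · linarith

end BudgetBandit

end

/-! ### The regret bound -/

theorem theorem3 {K : ℕ} (M : BudgetBandit K) (I : Fin K) (hI : M.IsUniqueBestArm I)
    (B : ℝ) (hB : M.cMin ≤ B) (A : PullingAlgorithm K) (hA : M.IsFractionalKUBE B A) :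
    M.regret B A ≤
      8 / M.dMin I ^ 2 *
          ((∑ j with 0 < M.meanDiff I j, M.meanDiff I j)
            + ∑ j with 0 < M.costDiff I j, M.costDiff I j / M.cost I) *
          Real.log (B / M.cMin)
        + ((∑ j with 0 < M.meanDiff I j, M.meanDiff I j)
            + ∑ j with 0 < M.costDiff I j, M.costDiff I j / M.cost I) *
          (Real.pi ^ 2 / 3 + 1)
        + 1 := by
  have : Nonempty (Fin K) := ⟨I⟩
  have hcI := M.cost_pos I
  have hc1 : 1 ≤ M.cMin := le_ciInf M.one_le_cost
  have hcost : ∀ i, M.cMin ≤ M.cost i := fun i => ciInf_le (Set.finite_range _).bddBelow i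
  have hB0 : 0 ≤ B := by linarith
  set ρ := M.mean I / M.cost I with hρdef
  have hρ : 0 ≤ ρ := div_nonneg (M.mean_nonneg I) hcI.le
  have hρI : ρ * M.cost I = M.mean I := div_mul_cancel₀ _ hcI.ne'
  have hbest : ∀ i, M.mean i ≤ ρ * M.cost i := by
    intro i
    rcases eq_or_ne i I with rfl | hi
    · exact hρI.ge
    · exact (div_le_iff₀ (M.cost_pos i)).1 (hI i hi).le
  set C : Fin K → ℝ := fun j => max 0 (M.meanDiff I j) + max 0 (M.costDiff I j / M.cost I)
    with hCdef
  have hC0 : ∀ j, 0 ≤ C j := fun j => add_nonneg (le_max_left _ _) (le_max_left _ _)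
  have hCsum : (∑ j with 0 < M.meanDiff I j, M.meanDiff I j)
      + ∑ j with 0 < M.costDiff I j, M.costDiff I j / M.cost I = ∑ j, C j := by
    rw [Finset.sum_filter, Finset.sum_filter, ← Finset.sum_add_distrib]
    refine Finset.sum_congr rfl fun j _ => ?_
    congr 1
    · split_ifs with h
      · exact (max_eq_right h.le).symm
      · exact (max_eq_left (not_lt.1 h)).symm
    · split_ifs with h
      · exact (max_eq_right (div_pos h hcI).le).symm
      · exact (max_eq_left (div_nonpos_of_nonpos_of_nonneg (not_lt.1 h) hcI.le)).symm
  have hC : ∀ j, ρ * M.cost j - M.mean j ≤ C j := by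
    intro j
    have h1 : ρ * M.cost j - M.mean j = M.meanDiff I j + ρ * M.costDiff I j := by
      unfold BudgetBandit.meanDiff BudgetBandit.costDiff
      linear_combination hρI
    have h2 : ρ * M.costDiff I j ≤ max 0 (M.costDiff I j / M.cost I) := by
      rcases le_total (M.costDiff I j) 0 with h | h
      · exact (mul_nonpos_of_nonneg_of_nonpos hρ h).trans (le_max_left _ _)
      · refine le_trans ?_ (le_max_right _ _)
        -- Here ρ ≤ 1 / c_I enters, through μ_I ≤ 1.
        rw [hρdef, div_mul_eq_mul_div]
        gcongr
        exact mul_le_of_le_one_left h (M.mean_le_one I)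
    rw [h1]
    exact add_le_add (le_max_right _ _) h2
  have hregret : M.regret B A
      ≤ ∫ ω, (ρ * B - ∑ t ∈ Finset.range ⌊B⌋₊, M.stepMean A ω.1 ω.2 t) ∂M.probability := by
    rw [integral_sub (integrable_const _)
      (integrable_finsetSum _ fun t _ => M.integrable_stepMean A t),
      ← M.expectedReward_eq (.of_forall fun ω => hA.totalCost_history_le hB0 ω.1 ω.2)]
    simpa [BudgetBandit.regret] using M.optimalReward_le hB0 hρ hbest
  set l := 8 / M.dMin I ^ 2 * Real.log (B / M.cMin) with hl
  have hpulls : ∀ j (ω : unitInterval × (Fin K × ℕ → ℝ)),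
      C j * ∑ t ∈ Finset.range ⌊B⌋₊, M.pullWhile B A I j ω.1 ω.2 t
        ≤ C j * (l + 1 + M.confidenceFailures I j ⌊B⌋₊ ω) := by
    intro j ω
    -- For the best arm `C` vanishes. Otherwise the infimum `dMin` runs over a finite nonempty
    -- family, so it is attained and hence positive.
    rcases eq_or_ne j I with rfl | hj
    · simp [hCdef, BudgetBandit.meanDiff, BudgetBandit.costDiff]
    · have : Nonempty {j : Fin K // j ≠ I} := ⟨⟨j, hj⟩⟩
      obtain ⟨i, hi⟩ := exists_eq_ciInf_of_finite
        (f := fun j : {j : Fin K // j ≠ I} => ρ - M.mean j / M.cost j)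
      have hd : 0 < M.dMin I := by
        have := hI i i.2
        exact (sub_pos.2 this).trans_eq hi
      have hgap : M.dMin I ≤ ρ - M.mean j / M.cost j :=
        ciInf_le (f := fun j : {j : Fin K // j ≠ I} => ρ - M.mean j / M.cost j)
          (Set.finite_range _).bddBelow ⟨j, hj⟩
      exact mul_le_mul_of_nonneg_left (hA.sum_pullWhile_le hB0 (by linarith) hcost hB hd hgap _ ω)
        (hC0 j)
  have hint : ∀ j, Integrable
      (fun ω => C j * (l + 1 + M.confidenceFailures I j ⌊B⌋₊ ω)) M.probability := fun j =>
    ((integrable_const _).add (BudgetBandit.integrable_confidenceFailures I j _)).const_mul _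
  calc M.regret B A
      ≤ ∫ ω, (ρ * B - ∑ t ∈ Finset.range ⌊B⌋₊, M.stepMean A ω.1 ω.2 t) ∂M.probability := hregret
    _ ≤ ∫ ω, (1 + ∑ j, C j * (l + 1 + M.confidenceFailures I j ⌊B⌋₊ ω)) ∂M.probability := by
      refine integral_mono ((integrable_const _).sub
          (integrable_finsetSum _ fun t _ => M.integrable_stepMean A t))
        ((integrable_const _).add (integrable_finsetSum _ fun j _ => hint j)) fun ω => ?_
      exact (hA.mul_sub_sum_stepMean_le hB0 hρ (hρI.trans_le (M.mean_le_one I)) hC0 hC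
        ω.1 ω.2).trans 
        (add_le_add_right (Finset.sum_le_sum fun j _ => hpulls j ω) 1)
    _ = 1 + ∑ j, C j * (l + 1 + ∫ ω, M.confidenceFailures I j ⌊B⌋₊ ω ∂M.probability) := by
      rw [integral_add (integrable_const _) (integrable_finsetSum _ fun j _ => hint j),
        integral_finsetSum _ fun j _ => hint j]
      congr 1
      · simp
      · refine Finset.sum_congr rfl fun j _ => ?_
        rw [integral_const_mul, integral_add (integrable_const _)
          (BudgetBandit.integrable_confidenceFailures I j _)]
        simp
    _ ≤ 1 + ∑ j, C j * (l + 1 + Real.pi ^ 2 / 3) := by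
      exact add_le_add_right (Finset.sum_le_sum fun j _ => mul_le_mul_of_nonneg_left
        (add_le_add_right (BudgetBandit.integral_confidenceFailures_le I j _) _) (hC0 j)) 1
    _ = _ := by
      rw [hCsum, ← Finset.sum_mul]
      ring
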